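/- Let $n\ge 3$ be an integer, $a>0$, $K>0$, $p\in(0,1]$, and put $\nu=a/(2n)$ and $\beta=(n-1)\nu/(pK)$. For a feedback gain $b_1\in\mathbb R$ consider on the torus $\mathbb T^n=(\mathbb R/2\pi\mathbb Z)^n$ the system $$\dot v_i=(2i-n-1)\nu+\frac{pK}{n}\sum_{j=1}^n\sin(v_j-v_i)-b_1\sin v_i,\qquad i=1,\dots,n.\tag{1}$$ For $\sigma\in\{-1,1\}^n$ and a real number $C$ with $pKC+b_1\ne0$, $(n-1)\nu\le|pKC+b_1|$ and $$C=\frac1n\sum_{i=1}^n\sigma_i\sqrt{1-\Big(\frac{(2i-n-1)\nu}{pKC+b_1}\Big)^2},$$ let $\phi_i=\arcsin\frac{(2i-n-1)\nu}{pKC+b_1}$ and let $v^\sigma$ be the point with $v^\sigma_i=\phi_i$ if $\sigma_i=1$, $v^\sigma_i=\pi-\phi_i$ if $\sigma_i=-1$ and $\phi_i\ge0$, and $v^\sigma_i=-\phi_i-\pi$ if $\sigma_i=-1$ and $\phi_i<0$; this is an equilibrium of (1). Its parameter is $\xi=(n-1)\nu/|pKC+b_1|\in(0,1]$. (For given $\sigma$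 and $b_1$ there may be no such $C$, or several; the statements below concern each of them.) Let $\chi(\xi)=\frac1n\sum_{i=1}^n\sqrt{1-\big(\frac{2i-n-1}{n-1}\xi\big)^2}$ for $\xi\in[0,1]$, and suppose that $\beta>\max_{\xi\in[0,1]}\xi\chi(\xi)$. Then the function $\bar\chi(\xi)=\xi/(\beta-\xi\chi(\xi))$ has exactly one point of local maximum $\xi_0$ in $(0,1)$, and for every $b_1>0$ the following hold. (i) An equilibrium $v^\sigma$ with $\sigma_i=1$ for all $i$ is asymptotically stable if its parameter satisfies $\xi<\xi_0$, and unstable if $\xi>\xi_0$. (ii) Every equilibrium $v^\sigma$ with $\sigma_i=-1$ for some $i$ is unstable. Here an equilibrium is called unstable if it is not Lyapunov stable, and asymptotically stable if it is Lyapunov stable and all solutions starting sufficiently close to it converge to it as $t\to\infty$. -/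

import Mathlib

open Real Set Filter Topology

noncomputable section

namespace ControlledKuramoto

/-! ### Stability of equilibria of an autonomous system of phase equations

Phases live on the torus `Fin n → Real.Angle`, each factor being the circle `ℝ / 2πℤ`. The vector
field `F` is written in lifted (real) coordinates, and so are its solutions; closeness and
convergence of states are always measured on the torus. -/

/-- The point of the torus with lifted coordinates `v`. -/
def toTorus {n : ℕ} (v : Fin n → ℝ) : Fin n → Real.Angle := fun i => (v i : Real.Angle)

/-- `v` solves `v' = F v` for all times `t ≥ 0`. -/
def IsSolution {n : ℕ} (F : (Fin n → ℝ) → (Fin n → ℝ)) (v : ℝ → (Fin n → ℝ)) : Prop :=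
  ∀ t, 0 ≤ t → HasDerivWithinAt v (F (v t)) (Ici 0) t

/-- Lyapunov stability of the point `ζ`. -/
def IsLyapunovStable {n : ℕ} (F : (Fin n → ℝ) → (Fin n → ℝ)) (ζ : Fin n → ℝ) : Prop :=
  ∀ ε > 0, ∃ δ > 0, ∀ v : ℝ → (Fin n → ℝ), IsSolution F v →
    dist (toTorus (v 0)) (toTorus ζ) < δ → ∀ t, 0 ≤ t → dist (toTorus (v t)) (toTorus ζ) < ε

/-- `ζ` is an equilibrium, it is Lyapunov stable, and it attracts all nearby solutions. -/
def IsAsymptoticallyStableEquilibrium {n : ℕ} (F : (Fin n → ℝ) → (Fin n → ℝ))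
    (ζ : Fin n → ℝ) : Prop :=
  F ζ = 0 ∧ IsLyapunovStable F ζ ∧
    ∃ δ > 0, ∀ v : ℝ → (Fin n → ℝ), IsSolution F v →
      dist (toTorus (v 0)) (toTorus ζ) < δ →
        Tendsto (fun t => toTorus (v t)) atTop (𝓝 (toTorus ζ))

/-- `ζ` is an equilibrium which is not Lyapunov stable. -/
def IsUnstableEquilibrium {n : ℕ} (F : (Fin n → ℝ) → (Fin n → ℝ)) (ζ : Fin n → ℝ) : Prop :=
  F ζ = 0 ∧ ¬ IsLyapunovStable F ζ

/-! ### The controlled Kuramoto model on the complete graph, in the rotating frame -/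

/-- The integer `2i - n - 1` for the node `i ∈ {1, …, n}`, which is the element `i - 1`
of `Fin n`. -/
def offset {n : ℕ} (i : Fin n) : ℝ := 2 * ((i : ℝ) + 1) - n - 1

/-- `ν = a / (2n)`. -/
def nu (n : ℕ) (a : ℝ) : ℝ := a / (2 * n)

/-- The vector field
`(2i - n - 1) ν + (pK / n) ∑ j, sin (v j - v i) - b₁ sin (v i)`. -/
def field (n : ℕ) (a p K b₁ : ℝ) (v : Fin n → ℝ) : Fin n → ℝ := fun i =>
  offset i * nu n a + p * K / n * ∑ j, Real.sin (v j - v i) - b₁ * Real.sin (v i)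

/-- The constant `C` is real and solves the self-consistency equation
`C = (1/n) ∑ i, σ i √(1 - ((2i - n - 1) ν / (pKC + b₁))²)`. The first two conditions say that the
equation is meaningful: no division by zero, and nonnegative radicands. -/
def IsConsistent {n : ℕ} (a p K b₁ : ℝ) (σ : Fin n → ℤˣ) (C : ℝ) : Prop :=
  p * K * C + b₁ ≠ 0 ∧
  (∀ i : Fin n, |offset i * nu n a / (p * K * C + b₁)| ≤ 1) ∧
  C = 1 / n * ∑ i : Fin n,
    ((σ i : ℤ) : ℝ) * √(1 - (offset i * nu n a / (p * K * C + b₁)) ^ 2)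

/-- `φ i = arcsin ((2i - n - 1) ν / (pKC + b₁))`. -/
def phi {n : ℕ} (a p K b₁ C : ℝ) (i : Fin n) : ℝ :=
  Real.arcsin (offset i * nu n a / (p * K * C + b₁))

/-- The equilibrium `v^σ` belonging to the sign sequence `σ` and the constant `C`. -/
def vSigma {n : ℕ} (a p K b₁ : ℝ) (σ : Fin n → ℤˣ) (C : ℝ) : Fin n → ℝ := fun i =>
  if σ i = 1 then phi a p K b₁ C i
  else if 0 ≤ phi a p K b₁ C i then π - phi a p K b₁ C i
  else -phi a p K b₁ C i - π

/-- The branch parameter `ξ = (n - 1) ν / |pKC + b₁|` of an equilibrium. -/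
def xi (n : ℕ) (a p K b₁ C : ℝ) : ℝ := ((n : ℝ) - 1) * nu n a / |p * K * C + b₁|

/-- `χ^σ(ξ) = (1/n) ∑ i, σ i √(1 - ((2i - n - 1) ξ / (n - 1))²)`. -/
def chi {n : ℕ} (σ : Fin n → ℤˣ) (ξ : ℝ) : ℝ :=
  1 / n * ∑ i : Fin n, ((σ i : ℤ) : ℝ) * √(1 - (offset i / ((n : ℝ) - 1) * ξ) ^ 2)

/-- `β = (n - 1) ν / (pK)`. -/
def beta (n : ℕ) (a p K : ℝ) : ℝ := ((n : ℝ) - 1) * nu n a / (p * K)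

/-- `χ̄^σ(ξ) = ξ / (β - ξ χ^σ(ξ))`, with the sign `+β` that belongs to `pKC + b₁ > 0`. -/
def chiBar {n : ℕ} (a p K : ℝ) (σ : Fin n → ℤˣ) (ξ : ℝ) : ℝ :=
  ξ / (beta n a p K - ξ * chi σ ξ)

/-- The sign sequence with all entries `+1`. -/
def allPlus (n : ℕ) : Fin n → ℤˣ := fun _ => 1

end ControlledKuramoto

end

/-! Write `κ = pKC + b₁`, `c = cos v`, `s = sin v` at an equilibrium `v`. Since `∑ s = 0` and `∑ c =
nC`, the linearization is the symmetric matrix `(pK/n)(c cᵀ + s sᵀ) - κ diag(c)`, so stability is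
read off from its quadratic form `Q` (`dotProduct_jacobian`).

If some `σ i = -1` and `κ > 0`, the diagonal entry `pK/n - κ c i` is positive. If `κ < 0`, either
some `c i ≥ 0` and the same entry is positive, or all `c i < 0` and the constant direction gives `Q
= -nC b₁ > 0`.

If all signs are `+1`, then `κ > 0`, and for `ξ < 1` the weights `c i` are positive. In the inner
product with weights `c`, the vectors `1` and `tan v` are orthogonal, with squared norms `nC` and `T
= ∑ s²/c`. By Bessel's inequality `Q` is negative definite as soon as `(pK/n) max(nC, T) < κ`. The
bound for `nC` is just `b₁ > 0`. Because `ξκ = pKβ` and `ξT = n · criticalFun n ξ`, the bound for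
`T` says `criticalFun n ξ < β`. The derivative of `χ̄` has the sign of `β - criticalFun n ξ`, and
`criticalFun` increases strictly from `0` to `∞` on `[0, 1)`, so both changes happen at one point
`ξ₀`.

Passing to the nonlinear flow uses quadratic Lyapunov functions: `|u|²` for stability, and `(J - μ)u
· u` with a suitable `μ > 0` for instability. -/

open scoped Matrix NNReal

namespace ControlledKuramoto

/-! ### Global solutions of a bounded Lipschitz vector field -/

/-- A bounded Lipschitz vector field has a solution on `[0, ∞)` through every point. -/
theorem exists_global_solution {E : Type*} [NormedAddCommGroup E] [NormedSpace ℝ E]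
    [CompleteSpace E] {F : E → E} {K L : ℝ≥0} (hF : LipschitzWith K F) (hL : ∀ x, ‖F x‖ ≤ L)
    (x : E) :
    ∃ v : ℝ → E, v 0 = x ∧ ∀ t, 0 ≤ t → HasDerivWithinAt v (F (v t)) (Ici 0) t := by
  have hex : ∀ N : ℕ, ∃ α : ℝ → E, α 0 = x ∧
      ∀ t ∈ Icc (0 : ℝ) (N + 1), HasDerivWithinAt α (F (α t)) (Icc (0 : ℝ) (N + 1)) t := by
    intro N
    have hN : (0 : ℝ) ≤ N + 1 := by positivity
    -- Speed at most `L` confines the solution to the ball of radius `L (N + 1)` up to time `N + 1`,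
    -- so Picard–Lindelöf covers the whole interval.
    have hpl : IsPicardLindelof (fun _ => F) (⟨0, le_rfl, hN⟩ : Icc (0 : ℝ) (N + 1)) x
        (L * (N + 1)) 0 L K :=
      { lipschitzOnWith := fun _ _ => hF.lipschitzOnWith
        continuousOn := fun _ _ => continuousOn_const
        norm_le := fun _ _ y _ => hL y
        mul_max_le := by simp [hN] }
    exact hpl.exists_eq_forall_mem_Icc_hasDerivWithinAt₀
  choose α hα0 hα using hex
  have hright : ∀ N : ℕ, ∀ t ∈ Ico (0 : ℝ) (N + 1),
      HasDerivWithinAt (α N) (F (α N t)) (Ici t) t := fun N t ht =>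
    (hα N t (Ico_subset_Icc_self ht)).mono_of_mem_nhdsWithin
      (mem_of_superset (Icc_mem_nhdsGE ht.2) (Icc_subset_Icc_left ht.1))
  have hagree : ∀ M N : ℕ, M ≤ N → EqOn (α M) (α N) (Icc (0 : ℝ) (M + 1)) := by
    intro M N hMN
    have hMN' : (M : ℝ) + 1 ≤ N + 1 := by gcongr
    exact ODE_solution_unique (fun _ => hF)
      (fun t ht => (hα M t ht).continuousWithinAt) (hright M)
      (fun t ht => ((hα N t ⟨ht.1, ht.2.trans hMN'⟩).mono
        (Icc_subset_Icc_right hMN')).continuousWithinAt)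
      (fun t ht => hright N t ⟨ht.1, ht.2.trans_le hMN'⟩)
      ((hα0 M).trans (hα0 N).symm)
  have hfloor : ∀ N : ℕ, ∀ s ∈ Ico (0 : ℝ) (N + 1), α ⌊s⌋₊ s = α N s := by
    intro N s hs
    refine hagree _ _ ?_ ⟨hs.1, (Nat.lt_floor_add_one s).le⟩
    have : ⌊s⌋₊ < N + 1 := (Nat.floor_lt hs.1).2 (by exact_mod_cast hs.2)
    omega
  -- Intervals end at `N + 1`, not `N`, so that `t < ⌊t⌋₊ + 1` lies strictly inside and a single `α
  -- N` describes the glued curve near `t`.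
  refine ⟨fun t => α ⌊t⌋₊ t, by simp [hα0], fun t ht => ?_⟩
  set N := ⌊t⌋₊
  have htN : t < N + 1 := Nat.lt_floor_add_one t
  have hmem : Ico (0 : ℝ) (N + 1) ∈ 𝓝[Ici 0] t :=
    inter_mem_nhdsWithin (Ici (0 : ℝ)) (Iio_mem_nhds htN)
  have h1 : HasDerivWithinAt (α N) (F (α N t)) (Ici 0) t :=
    (hα N t ⟨ht, htN.le⟩).mono_of_mem_nhdsWithin (mem_of_superset hmem Ico_subset_Icc_self)
  exact h1.congr_of_eventuallyEq (mem_of_superset hmem fun s hs => hfloor N s hs) rfl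

/-! ### Quadratic forms along solutions -/

section QuadraticForm

variable {n : ℕ}

theorem abs_dotProduct_le (x y : Fin n → ℝ) : |x ⬝ᵥ y| ≤ n * (‖x‖ * ‖y‖) := by
  calc |x ⬝ᵥ y| ≤ ∑ i, |x i * y i| := Finset.abs_sum_le_sum_abs _ _
    _ ≤ ∑ _i : Fin n, ‖x‖ * ‖y‖ := by
        refine Finset.sum_le_sum fun i _ => ?_
        rw [abs_mul]
        exact mul_le_mul (norm_le_pi_norm x i) (norm_le_pi_norm y i) (abs_nonneg _)
          (norm_nonneg _)
    _ = n * (‖x‖ * ‖y‖) := by simp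

theorem norm_sq_le_dotProduct_self (x : Fin n → ℝ) : ‖x‖ ^ 2 ≤ x ⬝ᵥ x := by
  have hnn : 0 ≤ x ⬝ᵥ x := Finset.sum_nonneg fun i _ => mul_self_nonneg (x i)
  have : ‖x‖ ≤ √(x ⬝ᵥ x) := by
    refine (pi_norm_le_iff_of_nonneg (sqrt_nonneg _)).2 fun i => ?_
    refine Real.abs_le_sqrt ?_
    rw [sq]
    exact Finset.single_le_sum (f := fun i => x i * x i) (fun i _ => mul_self_nonneg (x i))
      (Finset.mem_univ i)
  calc ‖x‖ ^ 2 ≤ √(x ⬝ᵥ x) ^ 2 := by gcongr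
    _ = x ⬝ᵥ x := Real.sq_sqrt hnn

variable {F : (Fin n → ℝ) → (Fin n → ℝ)} {ζ : Fin n → ℝ}
  {A J : (Fin n → ℝ) →L[ℝ] (Fin n → ℝ)}

/-- A strict differential inequality for a quadratic form along the linearized system persists,
without strictness, for the nonlinear system near the equilibrium. -/
theorem exists_growth_of_linearization (hζ : F ζ = 0) (hJ : HasFDerivAt F J ζ) {μ m : ℝ}
    (hm : 0 < m) (h : ∀ u, μ * (A u ⬝ᵥ u) + m * ‖u‖ ^ 2 ≤ A u ⬝ᵥ J u) :
    ∃ r > 0, ∀ u, ‖u‖ < r → μ * (A u ⬝ᵥ u) ≤ A u ⬝ᵥ F (ζ + u) := by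
  -- Chosen so that a remainder of size `c ‖u‖` contributes at most `m ‖u‖²`; the `+ 1` guards
  -- against `A = 0`.
  set c : ℝ := m / (n * ‖A‖ + 1)
  have hden : 0 < n * ‖A‖ + 1 := by positivity
  have hc : 0 < c := by positivity
  have hlittle := (hasFDerivAt_iff_isLittleO_nhds_zero.1 hJ).def hc
  obtain ⟨r, hr, hball⟩ := Metric.eventually_nhds_iff.1 hlittle
  refine ⟨r, hr, fun u hu => ?_⟩
  have hR := hball (y := u) (by simpa using hu)
  rw [hζ, sub_zero] at hR
  have hsplit : A u ⬝ᵥ F (ζ + u) = A u ⬝ᵥ J u + A u ⬝ᵥ (F (ζ + u) - J u) := by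
    rw [← dotProduct_add]; congr 1; abel
  have hbd : |A u ⬝ᵥ (F (ζ + u) - J u)| ≤ m * ‖u‖ ^ 2 := by
    calc |A u ⬝ᵥ (F (ζ + u) - J u)| ≤ n * (‖A u‖ * ‖F (ζ + u) - J u‖) := abs_dotProduct_le _ _
      _ ≤ n * ((‖A‖ * ‖u‖) * (c * ‖u‖)) := by
          gcongr
          exact A.le_opNorm u
      _ = (n * ‖A‖) * c * ‖u‖ ^ 2 := by ring
      _ ≤ (n * ‖A‖ + 1) * c * ‖u‖ ^ 2 := by gcongr; linarith
      _ = m * ‖u‖ ^ 2 := by rw [mul_div_cancel₀ _ hden.ne']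
  have := (abs_le.1 hbd).1
  linarith [h u]

theorem hasDerivWithinAt_quadraticForm (hA : ∀ u w, A u ⬝ᵥ w = u ⬝ᵥ A w) {u : ℝ → Fin n → ℝ}
    {u' : Fin n → ℝ} {s : Set ℝ} {t : ℝ} (hu : HasDerivWithinAt u u' s t) :
    HasDerivWithinAt (fun t => A (u t) ⬝ᵥ u t) (2 * (A (u t) ⬝ᵥ u')) s t := by
  have hAu : HasDerivWithinAt (fun t => A (u t)) (A u') s t :=
    A.hasFDerivAt.comp_hasDerivWithinAt t hu
  have h := HasDerivWithinAt.fun_sum (u := Finset.univ)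
    fun i _ => (hasDerivWithinAt_pi.1 hAu i).mul (hasDerivWithinAt_pi.1 hu i)
  have h2 : 2 * (A (u t) ⬝ᵥ u') = ∑ i, (A u' i * u t i + A (u t) i * u' i) := by
    rw [Finset.sum_add_distrib]
    change _ = A u' ⬝ᵥ u t + A (u t) ⬝ᵥ u'
    rw [hA u', dotProduct_comm u']
    ring
  rw [h2]
  exact h

/-- Along a solution that stays where the differential inequality holds, the quadratic form grows
at least exponentially with rate `2 μ`. -/
theorem exp_mul_le_quadraticForm (hA : ∀ u w, A u ⬝ᵥ w = u ⬝ᵥ A w) {μ r : ℝ}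
    (h : ∀ u, ‖u‖ < r → μ * (A u ⬝ᵥ u) ≤ A u ⬝ᵥ F (ζ + u)) {v : ℝ → Fin n → ℝ}
    (hv : IsSolution F v) (hr : ∀ t, 0 ≤ t → ‖v t - ζ‖ < r) {t : ℝ} (ht : 0 ≤ t) :
    Real.exp (2 * μ * t) * (A (v 0 - ζ) ⬝ᵥ (v 0 - ζ)) ≤ A (v t - ζ) ⬝ᵥ (v t - ζ) := by
  have hder : ∀ t, 0 ≤ t → HasDerivWithinAt
      (fun t => Real.exp (-(2 * μ * t)) * (A (v t - ζ) ⬝ᵥ (v t - ζ)))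
      (Real.exp (-(2 * μ * t)) * -(2 * μ) * (A (v t - ζ) ⬝ᵥ (v t - ζ)) +
        Real.exp (-(2 * μ * t)) * (2 * (A (v t - ζ) ⬝ᵥ F (v t)))) (Ici 0) t := by
    intro t ht
    have h1 : HasDerivWithinAt (fun t => v t - ζ) (F (v t)) (Ici 0) t := (hv t ht).sub_const ζ
    have h2 : HasDerivAt (fun t : ℝ => Real.exp (-(2 * μ * t)))
        (Real.exp (-(2 * μ * t)) * -(2 * μ)) t := by
      have := ((hasDerivAt_id t).const_mul (2 * μ)).neg.exp
      simpa using this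
    exact h2.hasDerivWithinAt.mul (hasDerivWithinAt_quadraticForm hA h1)
  -- Integrating factor: the hypothesis says that `exp (-2μt)` times the form has nonnegative
  -- derivative.
  have hmono : MonotoneOn (fun t => Real.exp (-(2 * μ * t)) * (A (v t - ζ) ⬝ᵥ (v t - ζ)))
      (Ici 0) := by
    refine monotoneOn_of_hasDerivWithinAt_nonneg (convex_Ici 0)
      (fun t ht => (hder t ht).continuousWithinAt)
      (fun t ht => (hder t (interior_subset ht)).mono interior_subset) fun t ht => ?_
    have := h (v t - ζ) (hr t (interior_subset ht))
    rw [add_sub_cancel] at this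
    have he := Real.exp_pos (-(2 * μ * t))
    nlinarith
  have := hmono (mem_Ici.2 le_rfl) ht ht
  simp only [mul_zero, neg_zero, Real.exp_zero, one_mul] at this
  calc _ ≤ Real.exp (2 * μ * t) * (Real.exp (-(2 * μ * t)) * (A (v t - ζ) ⬝ᵥ (v t - ζ))) := by
        gcongr
    _ = _ := by rw [← mul_assoc, ← Real.exp_add]; simp

/-- The Euclidean balls on which `|u|²` decreases are positively invariant. -/
theorem dotProduct_self_le_of_decreasing {m r ρ : ℝ} (hm : 0 < m) (hρ : 0 < ρ) (hρr : ρ < r)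
    (h : ∀ u, ‖u‖ < r → u ⬝ᵥ F (ζ + u) ≤ -m * (u ⬝ᵥ u)) {v : ℝ → Fin n → ℝ}
    (hv : IsSolution F v) (h0 : (v 0 - ζ) ⬝ᵥ (v 0 - ζ) ≤ ρ ^ 2) {t : ℝ} (ht : 0 ≤ t) :
    (v t - ζ) ⬝ᵥ (v t - ζ) ≤ ρ ^ 2 := by
  have hder : ∀ t, 0 ≤ t → HasDerivWithinAt (fun t => (v t - ζ) ⬝ᵥ (v t - ζ))
      (2 * ((v t - ζ) ⬝ᵥ F (v t))) (Ici 0) t := fun t ht =>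
    hasDerivWithinAt_quadraticForm (A := ContinuousLinearMap.id ℝ _) (fun _ _ => rfl)
      ((hv t ht).sub_const ζ)
  -- Barrier argument: wherever `|u|² = ρ²`, its derivative is at most `-2mρ² < 0`, so the sphere
  -- cannot be crossed outwards.
  refine image_le_of_deriv_right_lt_deriv_boundary' (a := 0) (b := t)
    (f := fun t => (v t - ζ) ⬝ᵥ (v t - ζ)) (f' := fun t => 2 * ((v t - ζ) ⬝ᵥ F (v t)))
    (B := fun _ => ρ ^ 2) (B' := fun _ => 0)
    (fun s hs => ((hder s hs.1).mono Icc_subset_Ici_self).continuousWithinAt)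
    (fun s hs => (hder s hs.1).mono (Ici_subset_Ici.2 hs.1)) h0 continuousOn_const
    (fun s _ => hasDerivWithinAt_const _ _ _) (fun s _ hs => ?_) ⟨ht, le_rfl⟩
  have hs' : (v s - ζ) ⬝ᵥ (v s - ζ) = ρ ^ 2 := hs
  have hlt : ‖v s - ζ‖ < r := by
    refine ((le_abs_self _).trans (abs_le_of_sq_le_sq ?_ hρ.le)).trans_lt hρr
    exact hs' ▸ norm_sq_le_dotProduct_self _
  have := h _ hlt
  rw [add_sub_cancel, hs'] at this
  have : 0 < m * ρ ^ 2 := by positivity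
  linarith

end QuadraticForm

/-! ### The distance on the torus and lifts -/

section Torus

variable {n : ℕ}

theorem angle_norm_coe (x : ℝ) :
    ‖(x : Real.Angle)‖ = |x - round ((2 * π)⁻¹ * x) * (2 * π)| := AddCircle.norm_eq (2 * π)

theorem angle_norm_coe_le (x : ℝ) : ‖(x : Real.Angle)‖ ≤ |x| := by
  rw [angle_norm_coe]
  have := round_le ((2 * π)⁻¹ * x) 0
  have hπ : 0 < 2 * π := by positivity
  calc |x - round ((2 * π)⁻¹ * x) * (2 * π)|
      = 2 * π * |(2 * π)⁻¹ * x - round ((2 * π)⁻¹ * x)| := by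
        rw [← abs_of_pos hπ, ← abs_mul, abs_of_pos hπ, mul_sub, mul_inv_cancel_left₀ hπ.ne',
          mul_comm (2 * π)]
    _ ≤ 2 * π * |(2 * π)⁻¹ * x| := by
        exact mul_le_mul_of_nonneg_left (by simpa only [Int.cast_zero, sub_zero] using this) hπ.le
    _ = |x| := by rw [← abs_of_pos hπ, ← abs_mul, abs_of_pos hπ, mul_inv_cancel_left₀ hπ.ne']

theorem angle_norm_coe_eq_abs {x : ℝ} (hx : |x| ≤ π) : ‖(x : Real.Angle)‖ = |x| :=
  (AddCircle.norm_coe_eq_abs_iff (2 * π) Real.two_pi_pos.ne').2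
    (by rw [abs_of_pos Real.two_pi_pos]; linarith)

theorem dist_toTorus_le (v w : Fin n → ℝ) : dist (toTorus v) (toTorus w) ≤ ‖v - w‖ := by
  refine (dist_pi_le_iff (norm_nonneg _)).2 fun i => ?_
  rw [dist_eq_norm]
  refine le_trans ?_ (norm_le_pi_norm (v - w) i)
  exact angle_norm_coe_le (v i - w i)

/-- The lifted coordinates can be shifted by multiples of `2π` to realize the distance. -/
theorem exists_shift_norm_sub_lt {v w : Fin n → ℝ} {δ : ℝ} (hδ : 0 < δ)
    (h : dist (toTorus v) (toTorus w) < δ) :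
    ∃ k : Fin n → ℤ, ‖(fun i => v i + k i * (2 * π)) - w‖ < δ := by
  refine ⟨fun i => -round ((2 * π)⁻¹ * (v i - w i)), (pi_norm_lt_iff hδ).2 fun i => ?_⟩
  have hi := (dist_pi_lt_iff hδ).1 h i
  rw [dist_eq_norm] at hi
  change ‖((v i - w i : ℝ) : Real.Angle)‖ < δ at hi
  rw [angle_norm_coe] at hi
  convert hi using 1
  simp only [Pi.sub_apply, Real.norm_eq_abs, Int.cast_neg]
  congr 1
  ring

/-- A curve that starts close to `w` and stays close to `w` on the torus stays close to `w` in
lifted coordinates. -/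
theorem norm_sub_lt_of_dist_toTorus_lt {v : ℝ → Fin n → ℝ} {w : Fin n → ℝ} {ε : ℝ}
    (hε : 0 < ε) (hεπ : ε ≤ π) (hv : ContinuousOn v (Ici 0)) (h0 : ‖v 0 - w‖ < ε)
    (h : ∀ t, 0 ≤ t → dist (toTorus (v t)) (toTorus w) < ε) {t : ℝ} (ht : 0 ≤ t) :
    ‖v t - w‖ < ε := by
  refine (pi_norm_lt_iff hε).2 fun i => ?_
  by_contra! hcon
  have hcont : ContinuousOn (fun s => |v s i - w i|) (Icc 0 t) := by
    have : ContinuousOn (fun s => v s i) (Icc 0 t) :=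
      (continuous_apply i).comp_continuousOn (hv.mono Icc_subset_Ici_self)
    exact (this.sub continuousOn_const).abs
  -- At a time when a coordinate is off by exactly `ε ≤ π`, the circle distance is also `ε`, which
  -- is forbidden.
  obtain ⟨s, hs, hse⟩ := intermediate_value_Icc ht hcont
    ⟨((norm_le_pi_norm (v 0 - w) i).trans_lt h0).le, hcon⟩
  have hi := (dist_pi_lt_iff hε).1 (h s hs.1) i
  rw [dist_eq_norm] at hi
  change ‖((v s i - w i : ℝ) : Real.Angle)‖ < ε at hi
  have hse' : |v s i - w i| = ε := hse
  rw [angle_norm_coe_eq_abs (hse'.le.trans hεπ)] at hi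
  linarith

end Torus

/-! ### Stability from the linearization -/

section Linearization

variable {n : ℕ} {F : (Fin n → ℝ) → (Fin n → ℝ)} {ζ : Fin n → ℝ}
  {J : (Fin n → ℝ) →L[ℝ] (Fin n → ℝ)}

/-- An equilibrium with negative definite linearization is asymptotically stable. -/
theorem isAsymptoticallyStableEquilibrium_of_neg_def
    (hper : ∀ v (k : Fin n → ℤ), F (fun i => v i + k i * (2 * π)) = F v)
    (hζ : F ζ = 0) (hJ : HasFDerivAt F J ζ) {m : ℝ} (hm : 0 < m)
    (h : ∀ u, u ⬝ᵥ J u ≤ -m * (u ⬝ᵥ u)) : IsAsymptoticallyStableEquilibrium F ζ := by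
  obtain ⟨r, hr, hdec⟩ : ∃ r > 0, ∀ u, ‖u‖ < r → u ⬝ᵥ F (ζ + u) ≤ -(m / 2) * (u ⬝ᵥ u) := by
    -- Decay of `|u|²` is growth of the form with `A = -id`; half of `m` is spent on absorbing the
    -- remainder.
    obtain ⟨r, hr, hdec⟩ := exists_growth_of_linearization
      (A := -ContinuousLinearMap.id ℝ (Fin n → ℝ)) (μ := -(m / 2)) (m := m / 2) hζ hJ (by positivity)
      (fun u => by
        have := h u
        have := norm_sq_le_dotProduct_self u
        simp only [neg_apply, ContinuousLinearMap.id_apply, neg_dotProduct]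
        nlinarith)
    refine ⟨r, hr, fun u hu => ?_⟩
    have := hdec u hu
    simp only [neg_apply, ContinuousLinearMap.id_apply, neg_dotProduct] at this
    linarith
  -- replaces a solution by a shifted one that starts close to `ζ` in lifted coordinates
  have hshift : ∀ ρ > 0, ∀ v, IsSolution F v →
      dist (toTorus (v 0)) (toTorus ζ) < ρ / (n + 1) → ∃ w, IsSolution F w ∧
        (∀ t, toTorus (w t) = toTorus (v t)) ∧ (w 0 - ζ) ⬝ᵥ (w 0 - ζ) ≤ ρ ^ 2 := by
    intro ρ hρ v hv hd
    obtain ⟨k, hk⟩ := exists_shift_norm_sub_lt (by positivity) hd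
    refine ⟨fun t i => v t i + k i * (2 * π), fun t ht => ?_, fun t => ?_, ?_⟩
    · rw [hper]
      exact (hv t ht).add_const (fun i => (k i : ℝ) * (2 * π))
    · ext i
      simp [toTorus]
    -- The Euclidean square is at most `n` times the squared sup norm, whence the factor `n + 1` in
    -- the radius.
    · refine (le_abs_self _).trans ((abs_dotProduct_le _ _).trans ?_)
      set y := ‖(fun i => v 0 i + k i * (2 * π)) - ζ‖
      have hy : 0 ≤ y := norm_nonneg _
      have hn : (0 : ℝ) ≤ n := by positivity
      have hy' : y * (n + 1) < ρ := (lt_div_iff₀ (by positivity)).1 hk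
      have : (y * (n + 1)) ^ 2 ≤ ρ ^ 2 := by gcongr
      nlinarith [mul_nonneg hn (sq_nonneg y), mul_nonneg (sq_nonneg (n : ℝ)) (sq_nonneg y), sq_nonneg y]
  have hbound : ∀ ρ > 0, ρ < r → ∀ w, IsSolution F w → (w 0 - ζ) ⬝ᵥ (w 0 - ζ) ≤ ρ ^ 2 →
      ∀ t, 0 ≤ t → ‖w t - ζ‖ ≤ ρ := by
    intro ρ hρ hρr w hw h0 t ht
    have := dotProduct_self_le_of_decreasing (half_pos hm) hρ hρr hdec hw h0 ht
    exact (le_abs_self _).trans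
      (abs_le_of_sq_le_sq ((norm_sq_le_dotProduct_self _).trans this) hρ.le)
  refine ⟨hζ, fun ε hε => ?_, ?_⟩
  · set ρ := min (ε / 2) (r / 2)
    have hρ : 0 < ρ := by positivity
    refine ⟨ρ / (n + 1), by positivity, fun v hv hd t ht => ?_⟩
    obtain ⟨w, hw, hwv, hw0⟩ := hshift ρ hρ v hv hd
    rw [← hwv]
    have h1 : ρ ≤ ε / 2 := min_le_left _ _
    have h2 : ρ ≤ r / 2 := min_le_right _ _
    have := hbound ρ hρ (by linarith) w hw hw0 t ht
    linarith [dist_toTorus_le (w t) ζ]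
  · refine ⟨r / 2 / (n + 1), by positivity, fun v hv hd => ?_⟩
    obtain ⟨w, hw, hwv, hw0⟩ := hshift (r / 2) (by positivity) v hv hd
    have hlt : ∀ t, 0 ≤ t → ‖w t - ζ‖ < r := fun t ht =>
      (hbound (r / 2) (by positivity) (by linarith) w hw hw0 t ht).trans_lt (by linarith)
    simp only [← hwv]
    have hsq : ∀ t, 0 ≤ t → ‖w t - ζ‖ ≤
        √(Real.exp (-(m * t)) * ((w 0 - ζ) ⬝ᵥ (w 0 - ζ))) := by
      intro t ht
      refine Real.le_sqrt_of_sq_le ((norm_sq_le_dotProduct_self _).trans ?_)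
      have := exp_mul_le_quadraticForm (A := -ContinuousLinearMap.id ℝ (Fin n → ℝ))
        (μ := -(m / 2)) (r := r) (F := F) (ζ := ζ) (fun u w => by simp)
        (fun u hu => by
          have := hdec u hu
          simp only [neg_apply, ContinuousLinearMap.id_apply, neg_dotProduct]
          linarith) hw hlt ht
      simp only [neg_apply, ContinuousLinearMap.id_apply,
        neg_dotProduct] at this
      rw [show 2 * -(m / 2) * t = -(m * t) by ring] at this
      linarith
    have hlim : Tendsto (fun t => √(Real.exp (-(m * t)) * ((w 0 - ζ) ⬝ᵥ (w 0 - ζ)))) atTop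
        (𝓝 0) := by
      have h1 : Tendsto (fun t => Real.exp (-(m * t))) atTop (𝓝 0) :=
        Real.tendsto_exp_neg_atTop_nhds_zero.comp (tendsto_id.const_mul_atTop hm)
      simpa using ((h1.mul_const ((w 0 - ζ) ⬝ᵥ (w 0 - ζ))).sqrt)
    refine tendsto_iff_dist_tendsto_zero.2 (squeeze_zero' (.of_forall fun _ => dist_nonneg) ?_ hlim)
    filter_upwards [eventually_ge_atTop 0] with t ht
    exact (dist_toTorus_le _ _).trans (hsq t ht)

/-- An equilibrium whose linearization is symmetric and positive in some direction is not
Lyapunov stable. -/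
theorem not_isLyapunovStable_of_pos_direction {K L : ℝ≥0} (hF : LipschitzWith K F)
    (hL : ∀ x, ‖F x‖ ≤ L) (hζ : F ζ = 0) (hJ : HasFDerivAt F J ζ)
    (hsymm : ∀ u w, J u ⬝ᵥ w = u ⬝ᵥ J w) {x : Fin n → ℝ} (hx : 0 < x ⬝ᵥ J x) :
    ¬ IsLyapunovStable F ζ := by
  have hxx : 0 < x ⬝ᵥ x := by
    have hx0 : x ≠ 0 := by rintro rfl; simp at hx
    exact (pow_pos (norm_pos_iff.2 hx0) 2).trans_le (norm_sq_le_dotProduct_self x)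
  -- Below the Rayleigh quotient of `x`, the form of `J - μ` is still positive at `x`. Only finitely
  -- many eigenvalues must be avoided, which makes `J - μ` injective, hence bounded below.
  obtain ⟨μ, ⟨hμ, hμx⟩, hμJ⟩ : ∃ μ ∈ Ioo 0 ((x ⬝ᵥ J x) / (x ⬝ᵥ x)),
      ¬ Module.End.HasEigenvalue (J : (Fin n → ℝ) →ₗ[ℝ] (Fin n → ℝ)) μ := by
    by_contra! hcon
    exact (Ioo_infinite (div_pos hx hxx))
      ((Module.End.finite_hasEigenvalue (J : Module.End ℝ (Fin n → ℝ))).subset hcon)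
  set A : (Fin n → ℝ) →L[ℝ] (Fin n → ℝ) := J - μ • ContinuousLinearMap.id ℝ _
  have hAapp : ∀ u, A u = J u - μ • u := fun u => rfl
  have hAsymm : ∀ u w, A u ⬝ᵥ w = u ⬝ᵥ A w := by
    intro u w
    simp [hAapp, hsymm]
  obtain ⟨c, hc, hcA⟩ : ∃ c > 0, ∀ u, c * ‖u‖ ^ 2 ≤ A u ⬝ᵥ A u := by
    have hker : LinearMap.ker (A : (Fin n → ℝ) →ₗ[ℝ] (Fin n → ℝ)) = ⊥ := by
      refine LinearMap.ker_eq_bot'.2 fun u hu => ?_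
      by_contra hu0
      refine hμJ (Module.End.hasEigenvalue_of_hasEigenvector (x := u) ?_)
      refine Module.End.hasEigenvector_iff.2 ⟨Module.End.mem_eigenspace_iff.2 ?_, hu0⟩
      exact sub_eq_zero.1 hu
    obtain ⟨C, hC, hCA⟩ := LinearMap.exists_antilipschitzWith _ hker
    refine ⟨((C : ℝ) ^ 2)⁻¹, by positivity, fun u => ?_⟩
    have h1 : ‖u‖ ≤ C * ‖A u‖ := by simpa using hCA.le_mul_dist u 0
    have hC' : (0 : ℝ) < C := hC
    rw [inv_mul_le_iff₀ (by positivity)]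
    calc ‖u‖ ^ 2 ≤ (C * ‖A u‖) ^ 2 := by gcongr
      _ = C ^ 2 * ‖A u‖ ^ 2 := by ring
      _ ≤ _ := by gcongr; exact norm_sq_le_dotProduct_self _
  -- `Au · Ju = |Au|² + μ (Au · u)`, and `|Au|²` supplies the strict margin.
  obtain ⟨r, hr, hgrow⟩ := exists_growth_of_linearization (A := A) (μ := μ) hζ hJ hc (fun u => by
    have h1 : A u ⬝ᵥ J u = A u ⬝ᵥ A u + μ * (A u ⬝ᵥ u) := by
      rw [show J u = A u + μ • u by simp [hAapp], dotProduct_add, dotProduct_smul, smul_eq_mul]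
    linarith [hcA u])
  intro hstab
  -- The cap `π` allows closeness on the torus to be lifted to `ℝⁿ`.
  set ε := min r π
  have hε : 0 < ε := lt_min hr pi_pos
  obtain ⟨δ, hδ, hst⟩ := hstab ε hε
  have hVx : 0 < A x ⬝ᵥ x := by
    rw [lt_div_iff₀ hxx] at hμx
    rw [hAapp, sub_dotProduct, smul_dotProduct, smul_eq_mul, dotProduct_comm]
    linarith
  obtain ⟨s, hs, hsx⟩ : ∃ s : ℝ, 0 < s ∧ ‖s • x‖ < min δ ε := by
    refine ⟨min δ ε / (2 * (‖x‖ + 1)), by positivity, ?_⟩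
    rw [norm_smul, Real.norm_of_nonneg (by positivity), div_mul_eq_mul_div,
      div_lt_iff₀ (by positivity)]
    have : 0 < min δ ε := by positivity
    nlinarith [norm_nonneg x]
  obtain ⟨v, hv0, hv⟩ := exists_global_solution hF hL (ζ + s • x)
  have hv0' : v 0 - ζ = s • x := by simp [hv0]
  have hd := hst v hv ((dist_toTorus_le _ _).trans_lt
    (by rw [hv0']; exact hsx.trans_le (min_le_left _ _)))
  have hnorm : ∀ t, 0 ≤ t → ‖v t - ζ‖ < ε := fun t ht =>
    norm_sub_lt_of_dist_toTorus_lt hε (min_le_right _ _)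
      (fun t ht => (hv t ht).continuousWithinAt)
      (by rw [hv0']; exact hsx.trans_le (min_le_right _ _)) hd ht
  have hVs : 0 < A (v 0 - ζ) ⬝ᵥ (v 0 - ζ) := by
    rw [hv0', map_smul, smul_dotProduct, dotProduct_smul, smul_eq_mul, smul_eq_mul]
    positivity
  have hexp : ∀ t, 0 ≤ t → Real.exp (2 * μ * t) * (A (v 0 - ζ) ⬝ᵥ (v 0 - ζ)) ≤
      n * (‖A‖ * ε * ε) := by
    intro t ht
    refine (exp_mul_le_quadraticForm hAsymm hgrow hv
      (fun t ht => (hnorm t ht).trans_le (min_le_left _ _)) ht).trans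
      ((le_abs_self _).trans ((abs_dotProduct_le _ _).trans ?_))
    have := (hnorm t ht).le
    gcongr
    exact (A.le_opNorm _).trans (by gcongr)
  have htop : Tendsto (fun t : ℝ => Real.exp (2 * μ * t) * (A (v 0 - ζ) ⬝ᵥ (v 0 - ζ))) atTop
      atTop :=
    (Real.tendsto_exp_atTop.comp (tendsto_id.const_mul_atTop (by positivity))).atTop_mul_const hVs
  obtain ⟨t, ht, htt⟩ := ((eventually_ge_atTop (0 : ℝ)).and
    (htop.eventually_gt_atTop (n * (‖A‖ * ε * ε)))).exists
  linarith [hexp t ht]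

end Linearization

end ControlledKuramoto

/-! ### Linearization at the equilibria, and instability when a sign is negative. -/

namespace ControlledKuramoto

/-! ### The vector field and its linearization -/

section Field

variable {n : ℕ} {a p K b₁ : ℝ}

theorem field_add_two_pi (v : Fin n → ℝ) (k : Fin n → ℤ) :
    field n a p K b₁ (fun i => v i + k i * (2 * π)) = field n a p K b₁ v := by
  funext i
  simp only [field, Real.sin_add_int_mul_two_pi]
  congr 3
  refine Finset.sum_congr rfl fun j _ => ?_
  rw [show v j + k j * (2 * π) - (v i + k i * (2 * π)) =
    v j - v i + ((k j - k i : ℤ) : ℝ) * (2 * π) by push_cast; ring,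
    Real.sin_add_int_mul_two_pi]

/-- With the Lipschitz bound, this guarantees the global solutions that refuting Lyapunov stability
requires. -/
theorem exists_norm_field_le : ∃ L : ℝ≥0, ∀ v, ‖field n a p K b₁ v‖ ≤ L := by
  set M : ℝ := ‖fun i : Fin n => offset i * nu n a‖ + |p * K / n| * n + |b₁|
  have hM : 0 ≤ M := by positivity
  refine ⟨⟨M, hM⟩, fun v => (pi_norm_le_iff_of_nonneg hM).2 fun i => ?_⟩
  have h1 : |offset i * nu n a| ≤ ‖fun i : Fin n => offset i * nu n a‖ :=
    norm_le_pi_norm (fun i : Fin n => offset i * nu n a) i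
  have h2 : |p * K / n * ∑ j, Real.sin (v j - v i)| ≤ |p * K / n| * n := by
    rw [abs_mul]
    gcongr
    calc |∑ j, Real.sin (v j - v i)| ≤ ∑ j, |Real.sin (v j - v i)| :=
          Finset.abs_sum_le_sum_abs _ _
      _ ≤ ∑ _j : Fin n, 1 := Finset.sum_le_sum fun j _ => Real.abs_sin_le_one _
      _ = n := by simp
  have h3 : |b₁ * Real.sin (v i)| ≤ |b₁| := by
    rw [abs_mul]
    exact mul_le_of_le_one_right (abs_nonneg _) (Real.abs_sin_le_one _)
  rw [Real.norm_eq_abs]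
  exact (abs_sub _ _).trans (add_le_add ((abs_add_le _ _).trans (add_le_add h1 h2)) h3)

theorem exists_lipschitzWith_field : ∃ L : ℝ≥0, LipschitzWith L (field n a p K b₁) := by
  set M : ℝ := |p * K / n| * (n * 2) + |b₁|
  have hM : 0 ≤ M := by positivity
  refine ⟨⟨M, hM⟩, LipschitzWith.of_dist_le_mul fun v w =>
    (dist_pi_le_iff (by positivity)).2 fun i => ?_⟩
  have hd : ∀ i, |v i - w i| ≤ dist v w := fun i => dist_le_pi_dist v w i
  have h1 : |∑ j, (Real.sin (v j - v i) - Real.sin (w j - w i))| ≤ n * 2 * dist v w := by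
    calc _ ≤ ∑ j, |Real.sin (v j - v i) - Real.sin (w j - w i)| := Finset.abs_sum_le_sum_abs _ _
      _ ≤ ∑ _j : Fin n, 2 * dist v w := Finset.sum_le_sum fun j _ => by
          refine (Real.abs_sin_sub_sin_le _ _).trans ?_
          rw [show v j - v i - (w j - w i) = (v j - w j) - (v i - w i) by ring]
          exact (abs_sub _ _).trans (by linarith [hd i, hd j])
      _ = n * 2 * dist v w := by simp [mul_assoc]
  rw [Real.dist_eq, show field n a p K b₁ v i - field n a p K b₁ w i =
    p * K / n * ∑ j, (Real.sin (v j - v i) - Real.sin (w j - w i)) -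
      b₁ * (Real.sin (v i) - Real.sin (w i)) by
    simp only [field, Finset.sum_sub_distrib]; ring]
  refine (abs_sub _ _).trans ?_
  rw [abs_mul, abs_mul]
  calc _ ≤ |p * K / n| * (n * 2 * dist v w) + |b₁| * dist v w := by
        gcongr
        exact (Real.abs_sin_sub_sin_le _ _).trans (hd i)
    _ = M * dist v w := by ring

variable (p K b₁) in
/-- The linearization of the vector field at `v`. -/
noncomputable def jacobian (v : Fin n → ℝ) : (Fin n → ℝ) →L[ℝ] (Fin n → ℝ) :=
  ContinuousLinearMap.pi fun i =>
    (p * K / n) • ∑ j, Real.cos (v j - v i) •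
        (ContinuousLinearMap.proj (R := ℝ) (φ := fun _ : Fin n => ℝ) j -
          ContinuousLinearMap.proj (R := ℝ) (φ := fun _ : Fin n => ℝ) i) -
      b₁ • Real.cos (v i) • ContinuousLinearMap.proj (R := ℝ) (φ := fun _ : Fin n => ℝ) i

theorem hasFDerivAt_field (v : Fin n → ℝ) :
    HasFDerivAt (field n a p K b₁) (jacobian p K b₁ v) v := by
  refine hasFDerivAt_pi.2 fun i => ?_
  have hproj : ∀ j : Fin n, HasFDerivAt (fun w : Fin n → ℝ => w j)
      (ContinuousLinearMap.proj (R := ℝ) (φ := fun _ : Fin n => ℝ) j) v :=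
    fun j => hasFDerivAt_apply j v
  exact ((HasFDerivAt.fun_sum fun j _ =>
    ((hproj j).sub (hproj i)).sin).const_mul (p * K / n) |>.const_add _).sub
      ((hproj i).sin.const_mul b₁)

/-- The addition formula for `cos (v j - v i)` splits the coupling into two rank-one parts. The
diagonal sums then simplify: `∑ sin` drops out, and `∑ cos` joins `b₁` to form `pKC + b₁`. -/
theorem jacobian_apply {v : Fin n → ℝ} {C : ℝ} (hn : n ≠ 0) (hs : ∑ i, Real.sin (v i) = 0)
    (hc : ∑ i, Real.cos (v i) = n * C) (y : Fin n → ℝ) (i : Fin n) :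
    jacobian p K b₁ v y i = p * K / n * (Real.cos (v i) * ∑ j, Real.cos (v j) * y j +
      Real.sin (v i) * ∑ j, Real.sin (v j) * y j) - (p * K * C + b₁) * Real.cos (v i) * y i := by
  have h1 : jacobian p K b₁ v y i =
      p * K / n * ∑ j, Real.cos (v j - v i) * (y j - y i) - b₁ * (Real.cos (v i) * y i) := by
    simp [jacobian]
  have h2 : ∑ j, Real.cos (v j - v i) * (y j - y i) =
      Real.cos (v i) * ∑ j, Real.cos (v j) * y j + Real.sin (v i) * ∑ j, Real.sin (v j) * y j -
        (∑ j, Real.cos (v j)) * (Real.cos (v i) * y i) -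
        (∑ j, Real.sin (v j)) * (Real.sin (v i) * y i) := by
    simp only [Finset.mul_sum, Finset.sum_mul, ← Finset.sum_add_distrib, ← Finset.sum_sub_distrib]
    refine Finset.sum_congr rfl fun j _ => ?_
    rw [Real.cos_sub]
    ring
  have hn' : (n : ℝ) ≠ 0 := Nat.cast_ne_zero.2 hn
  rw [h1, h2, hs, hc]
  field_simp
  ring

/-- The bilinear form of the linearization at a point with `∑ sin v = 0` and `∑ cos v = n C`. -/
theorem dotProduct_jacobian {v : Fin n → ℝ} {C : ℝ} (hn : n ≠ 0)
    (hs : ∑ i, Real.sin (v i) = 0) (hc : ∑ i, Real.cos (v i) = n * C) (x y : Fin n → ℝ) :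
    x ⬝ᵥ jacobian p K b₁ v y =
      p * K / n * ((∑ i, Real.cos (v i) * x i) * (∑ i, Real.cos (v i) * y i) +
        (∑ i, Real.sin (v i) * x i) * (∑ i, Real.sin (v i) * y i)) -
      (p * K * C + b₁) * ∑ i, Real.cos (v i) * (x i * y i) := by
  set X := ∑ j, Real.cos (v j) * y j
  set Y := ∑ j, Real.sin (v j) * y j
  calc x ⬝ᵥ jacobian p K b₁ v y = ∑ i, (p * K / n * ((Real.cos (v i) * x i) * X +
        (Real.sin (v i) * x i) * Y) - (p * K * C + b₁) * (Real.cos (v i) * (x i * y i))) := by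
        refine Finset.sum_congr rfl fun i _ => ?_
        rw [jacobian_apply hn hs hc]
        ring
    _ = _ := by
        rw [Finset.sum_sub_distrib, ← Finset.mul_sum, ← Finset.mul_sum, Finset.sum_add_distrib,
          ← Finset.sum_mul, ← Finset.sum_mul]

theorem jacobian_symm {v : Fin n → ℝ} {C : ℝ} (hn : n ≠ 0) (hs : ∑ i, Real.sin (v i) = 0)
    (hc : ∑ i, Real.cos (v i) = n * C) (x y : Fin n → ℝ) :
    jacobian p K b₁ v x ⬝ᵥ y = x ⬝ᵥ jacobian p K b₁ v y := by
  rw [dotProduct_comm, dotProduct_jacobian hn hs hc, dotProduct_jacobian hn hs hc]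
  congr 2
  · ring
  · simp only [mul_comm]

theorem field_apply (v : Fin n → ℝ) (i : Fin n) :
    field n a p K b₁ v i = offset i * nu n a + p * K / n *
      (Real.cos (v i) * ∑ j, Real.sin (v j) - Real.sin (v i) * ∑ j, Real.cos (v j)) -
      b₁ * Real.sin (v i) := by
  simp only [field]
  congr 3
  rw [Finset.mul_sum, Finset.mul_sum, ← Finset.sum_sub_distrib]
  refine Finset.sum_congr rfl fun j _ => ?_
  rw [Real.sin_sub]
  ring

end Field

/-! ### The equilibria -/

section Equilibria

variable {n : ℕ} {a p K b₁ C : ℝ} {σ : Fin n → ℤˣ}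

theorem sum_offset : ∑ i : Fin n, offset i = 0 := by
  have h : ∑ i : Fin n, offset (Fin.rev i) = ∑ i : Fin n, offset i :=
    Equiv.sum_comp Fin.revPerm (fun i : Fin n => offset i)
  have h2 : ∀ i : Fin n, offset (Fin.rev i) = -offset i := by
    intro i
    simp only [offset, Fin.val_rev]
    rw [Nat.cast_sub i.2]
    push_cast
    ring
  simp only [h2, Finset.sum_neg_distrib] at h
  linarith

theorem abs_offset_le (i : Fin n) : |offset i| ≤ (n : ℝ) - 1 := by
  have h : (i : ℝ) + 1 ≤ n := by exact_mod_cast i.2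
  have h0 : (0 : ℝ) ≤ (i : ℝ) := by positivity
  rw [abs_le]
  constructor <;> simp only [offset] <;> linarith

/-- The extreme node, whose sine is `ξ` in absolute value: it drives the blow-up of `criticalFun`
and the case `ξ = 1`. -/
theorem exists_offset_eq (hn : n ≠ 0) : ∃ i : Fin n, offset i = (n : ℝ) - 1 := by
  refine ⟨⟨n - 1, by omega⟩, ?_⟩
  simp only [offset]
  rw [Nat.cast_sub (by omega)]
  push_cast
  ring

theorem sin_vSigma (h : IsConsistent a p K b₁ σ C) (i : Fin n) :
    Real.sin (vSigma a p K b₁ σ C i) = offset i * nu n a / (p * K * C + b₁) := by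
  have hi := abs_le.1 (h.2.1 i)
  have hphi : Real.sin (phi a p K b₁ C i) = offset i * nu n a / (p * K * C + b₁) :=
    Real.sin_arcsin hi.1 hi.2
  simp only [vSigma]
  split_ifs
  · exact hphi
  · rw [Real.sin_pi_sub, hphi]
  · rw [Real.sin_sub_pi, Real.sin_neg, neg_neg, hphi]

theorem cos_vSigma (i : Fin n) :
    Real.cos (vSigma a p K b₁ σ C i) =
      ((σ i : ℤ) : ℝ) * √(1 - (offset i * nu n a / (p * K * C + b₁)) ^ 2) := by
  have hphi : Real.cos (phi a p K b₁ C i) =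
      √(1 - (offset i * nu n a / (p * K * C + b₁)) ^ 2) := Real.cos_arcsin _
  simp only [vSigma]
  rcases Int.units_eq_one_or (σ i) with hσ | hσ <;> rw [hσ, ← hphi]
  · simp
  · split_ifs
    · next h => exact absurd h (by decide)
    · simp
    · simp [Real.cos_sub_pi]

theorem sum_sin_vSigma (h : IsConsistent a p K b₁ σ C) :
    ∑ i, Real.sin (vSigma a p K b₁ σ C i) = 0 := by
  simp only [sin_vSigma h, ← Finset.sum_div, ← Finset.sum_mul, sum_offset, zero_mul, zero_div]

theorem sum_cos_vSigma (hn : n ≠ 0) (h : IsConsistent a p K b₁ σ C) :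
    ∑ i, Real.cos (vSigma a p K b₁ σ C i) = n * C := by
  have hn' : (n : ℝ) ≠ 0 := Nat.cast_ne_zero.2 hn
  simp only [cos_vSigma]
  conv_rhs => rw [h.2.2]
  rw [← mul_assoc, mul_one_div_cancel hn', one_mul]

theorem field_vSigma (hn : n ≠ 0) (h : IsConsistent a p K b₁ σ C) :
    field n a p K b₁ (vSigma a p K b₁ σ C) = 0 := by
  have hn' : (n : ℝ) ≠ 0 := Nat.cast_ne_zero.2 hn
  funext i
  rw [field_apply, sum_sin_vSigma h, sum_cos_vSigma hn h, sin_vSigma h]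
  have := h.1
  simp only [Pi.zero_apply]
  field_simp
  ring

theorem isUnstableEquilibrium_vSigma (hn : n ≠ 0) (h : IsConsistent a p K b₁ σ C)
    {x : Fin n → ℝ} (hx : 0 < x ⬝ᵥ jacobian p K b₁ (vSigma a p K b₁ σ C) x) :
    IsUnstableEquilibrium (field n a p K b₁) (vSigma a p K b₁ σ C) := by
  obtain ⟨M, hM⟩ := exists_lipschitzWith_field (n := n) (a := a) (p := p) (K := K) (b₁ := b₁)
  obtain ⟨L, hL⟩ := exists_norm_field_le (n := n) (a := a) (p := p) (K := K) (b₁ := b₁)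
  exact ⟨field_vSigma hn h, not_isLyapunovStable_of_pos_direction hM hL (field_vSigma hn h)
    (hasFDerivAt_field _) (jacobian_symm hn (sum_sin_vSigma h) (sum_cos_vSigma hn h)) hx⟩

/-- The quadratic form of the linearization at an equilibrium, in a coordinate direction. -/
theorem single_dotProduct_jacobian (hn : n ≠ 0) (h : IsConsistent a p K b₁ σ C) (i : Fin n) :
    (Pi.single i 1 : Fin n → ℝ) ⬝ᵥ
      jacobian p K b₁ (vSigma a p K b₁ σ C) (Pi.single i 1 : Fin n → ℝ) =
      p * K / n - (p * K * C + b₁) * Real.cos (vSigma a p K b₁ σ C i) := by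
  rw [dotProduct_jacobian hn (sum_sin_vSigma h) (sum_cos_vSigma hn h)]
  have h1 : ∀ f : Fin n → ℝ, ∑ j, f j * (Pi.single i 1 : Fin n → ℝ) j = f i := by
    intro f; simp [Pi.single_apply]
  have h2 : ∀ f : Fin n → ℝ, ∑ j, f j *
      ((Pi.single i 1 : Fin n → ℝ) j * (Pi.single i 1 : Fin n → ℝ) j) = f i := by
    intro f; simp [Pi.single_apply]
  rw [h1, h1, h2]
  have := Real.sin_sq_add_cos_sq (vSigma a p K b₁ σ C i)
  linear_combination p * K / n * this

/-- An equilibrium with some `σ i = -1` is unstable. -/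
theorem isUnstableEquilibrium_vSigma_of_exists_neg (hn : n ≠ 0) (hpK : 0 < p * K) (hb : 0 < b₁)
    (hσ : ∃ i, σ i = -1) (h : IsConsistent a p K b₁ σ C) :
    IsUnstableEquilibrium (field n a p K b₁) (vSigma a p K b₁ σ C) := by
  have hn' : (0 : ℝ) < n := by positivity
  have hk : 0 < p * K / n := by positivity
  rcases h.1.lt_or_gt with hκ | hκ
  · by_cases hcos : ∃ i, 0 ≤ Real.cos (vSigma a p K b₁ σ C i)
    · obtain ⟨i, hi⟩ := hcos
      refine isUnstableEquilibrium_vSigma hn h (x := Pi.single i 1) ?_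
      rw [single_dotProduct_jacobian hn h]
      nlinarith
    · push Not at hcos
      -- Uniform rotation: the coupling does no work, leaving `-b₁ ∑ cos = -nC b₁`, and `κ < 0 < b₁`
      -- forces `C < 0`.
      refine isUnstableEquilibrium_vSigma hn h (x := fun _ => 1) ?_
      rw [dotProduct_jacobian hn (sum_sin_vSigma h) (sum_cos_vSigma hn h)]
      simp only [mul_one, sum_sin_vSigma h, sum_cos_vSigma hn h]
      have hC : C < 0 := by
        have : p * K * C < 0 := by linarith
        exact (pos_iff_neg_of_mul_neg this).1 hpK
      have : p * K / n * (n * C * (n * C) + 0 * 0) - (p * K * C + b₁) * (n * C) =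
          n * (-C) * b₁ := by
        field_simp
        ring
      rw [this]
      have := neg_pos.2 hC
      positivity
  · obtain ⟨i, hi⟩ := hσ
    refine isUnstableEquilibrium_vSigma hn h (x := Pi.single i 1) ?_
    rw [single_dotProduct_jacobian hn h, cos_vSigma, hi]
    have := Real.sqrt_nonneg (1 - (offset i * nu n a / (p * K * C + b₁)) ^ 2)
    have : 0 ≤ (p * K * C + b₁) * √(1 - (offset i * nu n a / (p * K * C + b₁)) ^ 2) := by
      positivity
    push_cast
    linarith

end Equilibria

end ControlledKuramoto

/-! ### The critical parameter, and its role for the all-plus equilibria. -/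

namespace ControlledKuramoto

/-! ### The local maximum of `χ̄` -/

section CriticalParameter

variable {n : ℕ} {a p K : ℝ}

/-- The function `-ξ² χ'(ξ)`, whose comparison with `β` decides the sign of `χ̄'(ξ)`. -/
noncomputable def criticalFun (n : ℕ) (ξ : ℝ) : ℝ :=
  ξ ^ 3 * (1 / n * ∑ i : Fin n,
    (offset i / ((n : ℝ) - 1)) ^ 2 / √(1 - (offset i / ((n : ℝ) - 1) * ξ) ^ 2))

theorem abs_offset_div_le (hn : 2 ≤ n) (i : Fin n) : |offset i / ((n : ℝ) - 1)| ≤ 1 := by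
  have h2 : (2 : ℝ) ≤ n := by exact_mod_cast hn
  have h : (0 : ℝ) < (n : ℝ) - 1 := by linarith
  rw [abs_div, abs_of_pos h, div_le_one h]
  exact abs_offset_le i

theorem one_sub_sq_le_radicand (hn : 2 ≤ n) (i : Fin n) (ξ : ℝ) :
    1 - ξ ^ 2 ≤ 1 - (offset i / ((n : ℝ) - 1) * ξ) ^ 2 := by
  have h := (sq_le_one_iff_abs_le_one _).2 (abs_offset_div_le hn i)
  rw [mul_pow]
  nlinarith [mul_le_mul_of_nonneg_right h (sq_nonneg ξ)]

theorem radicand_pos (hn : 2 ≤ n) (i : Fin n) {ξ : ℝ} (h0 : 0 ≤ ξ) (h1 : ξ < 1) :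
    0 < 1 - (offset i / ((n : ℝ) - 1) * ξ) ^ 2 := by
  have := one_sub_sq_le_radicand hn i ξ
  nlinarith

theorem hasDerivAt_sqrt_one_sub_mul_sq (r : ℝ) {ξ : ℝ} (h : 0 < 1 - (r * ξ) ^ 2) :
    HasDerivAt (fun ξ => √(1 - (r * ξ) ^ 2)) (-(r ^ 2 / √(1 - (r * ξ) ^ 2) * ξ)) ξ := by
  have h1 : HasDerivAt (fun ξ => r * ξ) r ξ := by
    simpa using (hasDerivAt_id ξ).const_mul r
  refine (((h1.fun_pow 2).const_sub 1).sqrt h.ne').congr_deriv ?_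
  push_cast
  ring

theorem hasDerivAt_chi_allPlus (hn : 2 ≤ n) {ξ : ℝ} (h0 : 0 < ξ) (h1 : ξ < 1) :
    HasDerivAt (chi (allPlus n)) (-(criticalFun n ξ / ξ ^ 2)) ξ := by
  have hterm : ∀ i : Fin n, HasDerivAt
      (fun ξ => ((allPlus n i : ℤ) : ℝ) * √(1 - (offset i / ((n : ℝ) - 1) * ξ) ^ 2))
      (-((offset i / ((n : ℝ) - 1)) ^ 2 / √(1 - (offset i / ((n : ℝ) - 1) * ξ) ^ 2) * ξ)) ξ := by
    intro i
    simp only [allPlus, Units.val_one, Int.cast_one, one_mul]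
    exact hasDerivAt_sqrt_one_sub_mul_sq _ (radicand_pos hn i h0.le h1)
  have h := (HasDerivAt.fun_sum (u := Finset.univ) fun i _ => hterm i).const_mul (1 / (n : ℝ))
  refine HasDerivAt.congr_deriv (f := chi (allPlus n)) h ?_
  rw [criticalFun, Finset.sum_neg_distrib, ← Finset.sum_mul]
  generalize (∑ i : Fin n,
      (offset i / ((n : ℝ) - 1)) ^ 2 / √(1 - (offset i / ((n : ℝ) - 1) * ξ) ^ 2)) = S
  field_simp

theorem hasDerivAt_chiBar_allPlus (hn : 2 ≤ n) {ξ : ℝ} (h0 : 0 < ξ) (h1 : ξ < 1)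
    (hβ : ξ * chi (allPlus n) ξ < beta n a p K) :
    HasDerivAt (chiBar a p K (allPlus n))
      ((beta n a p K - criticalFun n ξ) / (beta n a p K - ξ * chi (allPlus n) ξ) ^ 2) ξ := by
  have hden : beta n a p K - ξ * chi (allPlus n) ξ ≠ 0 := by linarith
  have h := (hasDerivAt_id' ξ).fun_div
    (((hasDerivAt_id' ξ).fun_mul (hasDerivAt_chi_allPlus hn h0 h1)).const_sub (beta n a p K)) hden
  refine HasDerivAt.congr_deriv (f := chiBar a p K (allPlus n)) h ?_
  congr 1
  field_simp
  ring

/-- Only the term of the extreme node is kept. It yields both positivity of the sum and divergence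
as `ξ → 1`. -/
theorem le_criticalSum (hn : 2 ≤ n) (ξ : ℝ) :
    1 / (n * √(1 - ξ ^ 2)) ≤ 1 / n * ∑ i : Fin n,
      (offset i / ((n : ℝ) - 1)) ^ 2 / √(1 - (offset i / ((n : ℝ) - 1) * ξ) ^ 2) := by
  have h2 : (2 : ℝ) ≤ n := by exact_mod_cast hn
  obtain ⟨i, hi⟩ := exists_offset_eq (n := n) (by omega)
  rw [← div_div, div_eq_mul_one_div (1 / (n : ℝ))]
  gcongr
  have hle := Finset.single_le_sum (f := fun i : Fin n =>
    (offset i / ((n : ℝ) - 1)) ^ 2 / √(1 - (offset i / ((n : ℝ) - 1) * ξ) ^ 2))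
    (fun i _ => by positivity) (Finset.mem_univ i)
  simp only [hi, div_self (show (n : ℝ) - 1 ≠ 0 by linarith), one_pow, one_mul] at hle
  exact hle

/-- Each summand is weakly increasing because its denominator shrinks; strictness comes from the
factor `ξ³`. -/
theorem strictMonoOn_criticalFun (hn : 2 ≤ n) : StrictMonoOn (criticalFun n) (Ico 0 1) := by
  have h2 : (2 : ℝ) ≤ n := by exact_mod_cast hn
  intro x hx y hy hxy
  have hy1 : 0 < 1 - y ^ 2 := by nlinarith [hy.1, hy.2]
  calc criticalFun n x ≤ x ^ 3 * (1 / n * ∑ i : Fin n,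
        (offset i / ((n : ℝ) - 1)) ^ 2 / √(1 - (offset i / ((n : ℝ) - 1) * y) ^ 2)) := by
        have hx3 : 0 ≤ x ^ 3 := pow_nonneg hx.1 3
        refine mul_le_mul_of_nonneg_left (mul_le_mul_of_nonneg_left
          (Finset.sum_le_sum fun i _ => ?_) (by positivity)) hx3
        have := radicand_pos hn i hy.1 hy.2
        have hx0 := hx.1
        refine div_le_div_of_nonneg_left (by positivity) (Real.sqrt_pos.2 this)
          (Real.sqrt_le_sqrt ?_)
        rw [mul_pow, mul_pow]
        gcongr
    _ < criticalFun n y := by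
        refine mul_lt_mul_of_pos_right (pow_lt_pow_left₀ hxy hx.1 (by norm_num)) ?_
        exact lt_of_lt_of_le (by positivity) (le_criticalSum hn y)

theorem continuousOn_criticalFun (hn : 2 ≤ n) : ContinuousOn (criticalFun n) (Ico 0 1) := by
  refine (continuousOn_pow 3).mul (continuousOn_const.mul
    (continuousOn_finsetSum _ fun i _ => continuousOn_const.div ?_ fun x hx =>
      (Real.sqrt_pos.2 (radicand_pos hn i hx.1 hx.2)).ne'))
  fun_prop

theorem exists_lt_criticalFun (hn : 2 ≤ n) (B : ℝ) : ∃ ξ ∈ Ioo (0 : ℝ) 1, B < criticalFun n ξ := by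
  have h2 : (2 : ℝ) ≤ n := by exact_mod_cast hn
  -- At `ξ = √(1 - e²)` the lower bound on the sum is `1 / (n e)`, and `ξ ≥ 1/2` gives `ξ³ ≥ 1/8`;
  -- `e` makes the product equal `|B| + 1`.
  set e : ℝ := 1 / (8 * n * (|B| + 1))
  have hB := abs_nonneg B
  have he : 0 < e := by positivity
  have he2 : e ≤ 1 / 2 := by
    refine one_div_le_one_div_of_le (by norm_num) ?_
    nlinarith
  have hrad : 0 < 1 - e ^ 2 := by nlinarith
  have hhalf : 1 / 2 ≤ √(1 - e ^ 2) := Real.le_sqrt_of_sq_le (by nlinarith)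
  have h1 : √(1 - e ^ 2) < 1 := by
    rw [Real.sqrt_lt' one_pos]
    nlinarith [pow_pos he 2]
  have hsq : √(1 - √(1 - e ^ 2) ^ 2) = e := by
    rw [Real.sq_sqrt hrad.le, sub_sub_cancel, Real.sqrt_sq he.le]
  refine ⟨√(1 - e ^ 2), ⟨by linarith, h1⟩, ?_⟩
  have hs := le_criticalSum hn √(1 - e ^ 2)
  rw [hsq] at hs
  calc B ≤ |B| := le_abs_self B
    _ < |B| + 1 := by linarith
    _ = (1 / 2) ^ 3 * (1 / (n * e)) := by
        simp only [e]
        field_simp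
        norm_num
    _ ≤ criticalFun n √(1 - e ^ 2) := by
        refine mul_le_mul ?_ hs (by positivity) (by positivity)
        gcongr

theorem exists_criticalFun_eq (hn : 2 ≤ n) {B : ℝ} (hB : 0 < B) :
    ∃ ξ ∈ Ioo (0 : ℝ) 1, criticalFun n ξ = B := by
  obtain ⟨ξ, hξ, hlt⟩ := exists_lt_criticalFun hn B
  have h0 : criticalFun n 0 = 0 := by simp [criticalFun]
  obtain ⟨x, hx, hxB⟩ := intermediate_value_Ioo hξ.1.le
    ((continuousOn_criticalFun hn).mono fun y hy => ⟨hy.1, hy.2.trans_lt hξ.2⟩)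
    ⟨h0.trans_lt hB, hlt⟩
  exact ⟨x, ⟨hx.1, hx.2.trans hξ.2⟩, hxB⟩

/-- The derivative has the sign of `β - criticalFun n ξ`, which is strictly decreasing and vanishes
only at `ξ₀`. -/
theorem isLocalMax_chiBar_iff (hn : 2 ≤ n)
    (hβ : ∀ ξ ∈ Icc (0 : ℝ) 1, ξ * chi (allPlus n) ξ < beta n a p K) {ξ₀ : ℝ}
    (hξ₀ : ξ₀ ∈ Ioo (0 : ℝ) 1) (hcrit : criticalFun n ξ₀ = beta n a p K) {ξ : ℝ}
    (hξ : ξ ∈ Ioo (0 : ℝ) 1) : IsLocalMax (chiBar a p K (allPlus n)) ξ ↔ ξ = ξ₀ := by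
  have hmono := strictMonoOn_criticalFun hn
  have hder : ∀ ξ ∈ Ioo (0 : ℝ) 1, HasDerivAt (chiBar a p K (allPlus n))
      ((beta n a p K - criticalFun n ξ) / (beta n a p K - ξ * chi (allPlus n) ξ) ^ 2) ξ :=
    fun ξ hξ => hasDerivAt_chiBar_allPlus hn hξ.1 hξ.2 (hβ ξ (Ioo_subset_Icc_self hξ))
  have hIco : ∀ {ξ}, ξ ∈ Ioo (0 : ℝ) 1 → ξ ∈ Ico (0 : ℝ) 1 := fun h => Ioo_subset_Ico_self h
  constructor
  · intro hmax
    have h0 := hmax.hasDerivAt_eq_zero (hder ξ hξ)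
    have hden : beta n a p K - ξ * chi (allPlus n) ξ ≠ 0 := by
      linarith [hβ ξ (Ioo_subset_Icc_self hξ)]
    rw [div_eq_zero_iff, or_iff_left (pow_ne_zero 2 hden)] at h0
    exact hmono.injOn (hIco hξ) (hIco hξ₀) (by linarith)
  · rintro rfl
    refine isLocalMax_of_deriv_Ioo hξ.1 hξ.2 (hder ξ hξ).continuousAt
      (fun x hx => (hder x ⟨hx.1, hx.2.trans hξ.2⟩).differentiableAt.differentiableWithinAt)
      (fun x hx => (hder x ⟨hξ.1.trans hx.1, hx.2⟩).differentiableAt.differentiableWithinAt)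
      (fun x hx => ?_) (fun x hx => ?_)
    · have hx' : x ∈ Ioo (0 : ℝ) 1 := ⟨hx.1, hx.2.trans hξ.2⟩
      rw [(hder x hx').deriv]
      have := hmono (hIco hx') (hIco hξ) hx.2
      exact div_nonneg (by linarith) (sq_nonneg _)
    · have hx' : x ∈ Ioo (0 : ℝ) 1 := ⟨hξ.1.trans hx.1, hx.2⟩
      rw [(hder x hx').deriv]
      have := hmono (hIco hξ) (hIco hx') hx.1
      exact div_nonpos_of_nonpos_of_nonneg (by linarith) (sq_nonneg _)

end CriticalParameter

/-! ### The equilibria with all signs positive -/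

section AllPlus

variable {n : ℕ} {a p K b₁ C : ℝ}

theorem nu_pos (hn : n ≠ 0) (ha : 0 < a) : 0 < nu n a := by
  have : (0 : ℝ) < n := by positivity
  exact div_pos ha (by positivity)

theorem consistent_allPlus_nonneg (h : IsConsistent a p K b₁ (allPlus n) C) : 0 ≤ C := by
  rw [h.2.2]
  simp only [allPlus, Units.val_one, Int.cast_one, one_mul]
  positivity

theorem consistent_allPlus_pos (hpK : 0 < p * K) (hb : 0 < b₁)
    (h : IsConsistent a p K b₁ (allPlus n) C) : 0 < p * K * C + b₁ := by
  have := consistent_allPlus_nonneg h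
  positivity

theorem xi_mul_eq (hpK : 0 < p * K) (hκ : 0 < p * K * C + b₁) :
    (p * K * C + b₁) * xi n a p K b₁ C = p * K * beta n a p K := by
  rw [xi, beta, abs_of_pos hκ, mul_div_cancel₀ _ hκ.ne', mul_div_cancel₀ _ hpK.ne']

theorem offset_mul_nu_div (hn : 2 ≤ n) (hκ : 0 < p * K * C + b₁) (i : Fin n) :
    offset i * nu n a / (p * K * C + b₁) = offset i / ((n : ℝ) - 1) * xi n a p K b₁ C := by
  have h2 : (2 : ℝ) ≤ n := by exact_mod_cast hn
  have h : (n : ℝ) - 1 ≠ 0 := by linarith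
  rw [xi, abs_of_pos hκ]
  field_simp

theorem xi_pos (hn : 2 ≤ n) (ha : 0 < a) (hκ : 0 < p * K * C + b₁) : 0 < xi n a p K b₁ C := by
  have h2 : (2 : ℝ) ≤ n := by exact_mod_cast hn
  have h : 0 < (n : ℝ) - 1 := by linarith
  have := nu_pos (n := n) (by omega) ha
  rw [xi, abs_of_pos hκ]
  positivity

variable (a p K b₁ C) in
/-- The weighted sum `∑ sin² v / cos v` at the equilibrium with all signs positive. -/
noncomputable def tangentSum (n : ℕ) : ℝ :=
  ∑ i : Fin n, Real.sin (vSigma a p K b₁ (allPlus n) C i) ^ 2 /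
    Real.cos (vSigma a p K b₁ (allPlus n) C i)

theorem sin_vSigma_allPlus (hn : 2 ≤ n) (hpK : 0 < p * K) (hb : 0 < b₁)
    (h : IsConsistent a p K b₁ (allPlus n) C) (i : Fin n) :
    Real.sin (vSigma a p K b₁ (allPlus n) C i) =
      offset i / ((n : ℝ) - 1) * xi n a p K b₁ C := by
  rw [sin_vSigma h, offset_mul_nu_div hn (consistent_allPlus_pos hpK hb h)]

theorem cos_vSigma_allPlus (hn : 2 ≤ n) (hpK : 0 < p * K) (hb : 0 < b₁)
    (h : IsConsistent a p K b₁ (allPlus n) C) (i : Fin n) :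
    Real.cos (vSigma a p K b₁ (allPlus n) C i) =
      √(1 - (offset i / ((n : ℝ) - 1) * xi n a p K b₁ C) ^ 2) := by
  rw [cos_vSigma, offset_mul_nu_div hn (consistent_allPlus_pos hpK hb h)]
  simp [allPlus]

/-- The bridge between the spectral condition on `T` and the monotonicity of `χ̄`. -/
theorem xi_mul_tangentSum (hn : 2 ≤ n) (hpK : 0 < p * K) (hb : 0 < b₁)
    (h : IsConsistent a p K b₁ (allPlus n) C) :
    xi n a p K b₁ C * tangentSum a p K b₁ C n = n * criticalFun n (xi n a p K b₁ C) := by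
  have hn' : (n : ℝ) ≠ 0 := Nat.cast_ne_zero.2 (by omega)
  set ξ := xi n a p K b₁ C
  have : tangentSum a p K b₁ C n = ξ ^ 2 * ∑ i : Fin n,
      (offset i / ((n : ℝ) - 1)) ^ 2 / √(1 - (offset i / ((n : ℝ) - 1) * ξ) ^ 2) := by
    rw [tangentSum, Finset.mul_sum]
    refine Finset.sum_congr rfl fun i _ => ?_
    rw [sin_vSigma_allPlus hn hpK hb h, cos_vSigma_allPlus hn hpK hb h]
    ring
  rw [this, criticalFun]
  generalize (∑ i : Fin n,
      (offset i / ((n : ℝ) - 1)) ^ 2 / √(1 - (offset i / ((n : ℝ) - 1) * ξ) ^ 2)) = S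
  field_simp

theorem cos_vSigma_allPlus_pos (hn : 2 ≤ n) (ha : 0 < a) (hpK : 0 < p * K) (hb : 0 < b₁)
    (h : IsConsistent a p K b₁ (allPlus n) C) (hξ : xi n a p K b₁ C < 1) (i : Fin n) :
    0 < Real.cos (vSigma a p K b₁ (allPlus n) C i) := by
  rw [cos_vSigma_allPlus hn hpK hb h]
  exact Real.sqrt_pos.2
    (radicand_pos hn i (xi_pos hn ha (consistent_allPlus_pos hpK hb h)).le hξ)

/-- The equilibrium with all signs positive is asymptotically stable where `χ̄` increases. -/
theorem isAsymptoticallyStable_vSigma_allPlus (hn : 2 ≤ n) (ha : 0 < a) (hpK : 0 < p * K)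
    (hb : 0 < b₁) (h : IsConsistent a p K b₁ (allPlus n) C) (hξ : xi n a p K b₁ C < 1)
    (hcrit : criticalFun n (xi n a p K b₁ C) < beta n a p K) :
    IsAsymptoticallyStableEquilibrium (field n a p K b₁) (vSigma a p K b₁ (allPlus n) C) := by
  have hn0 : n ≠ 0 := by omega
  have hn' : (0 : ℝ) < n := by positivity
  have hκ := consistent_allPlus_pos hpK hb h
  have hξ0 := xi_pos hn ha hκ
  have hcos := cos_vSigma_allPlus_pos hn ha hpK hb h hξ
  have hsin0 := sum_sin_vSigma h
  have hcosC := sum_cos_vSigma hn0 h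
  have hxb := xi_mul_eq (n := n) (a := a) hpK hκ
  have hxt := xi_mul_tangentSum hn hpK hb h
  have hc0 : ∀ i, √(1 - xi n a p K b₁ C ^ 2) ≤ Real.cos (vSigma a p K b₁ (allPlus n) C i) := by
    intro i
    rw [cos_vSigma_allPlus hn hpK hb h]
    exact Real.sqrt_le_sqrt (one_sub_sq_le_radicand hn i _)
  -- After multiplication by `nξ > 0` this is `npK` times `criticalFun n ξ < β`.
  have hT : p * K / n * tangentSum a p K b₁ C n < p * K * C + b₁ := by
    rw [div_mul_eq_mul_div, div_lt_iff₀ hn']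
    refine lt_of_mul_lt_mul_left ?_ hξ0.le
    nlinarith [mul_lt_mul_of_pos_left hcrit (mul_pos hn' hpK)]
  have hC : p * K / n * (n * C) < p * K * C + b₁ := by
    rw [← mul_assoc, div_mul_cancel₀ _ hn'.ne']
    linarith
  set s : Fin n → ℝ := fun i => Real.sin (vSigma a p K b₁ (allPlus n) C i) with hs
  set c : Fin n → ℝ := fun i => Real.cos (vSigma a p K b₁ (allPlus n) C i) with hc
  set T := tangentSum a p K b₁ C n with hTdef
  set κ := p * K * C + b₁
  set M := max (n * C) T
  have hM : p * K / n * M < κ := by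
    rcases max_choice (n * C) T with hmax | hmax <;> simp only [M, hmax] <;> assumption
  have hMpos : 0 < M := by
    refine lt_of_lt_of_le ?_ (le_max_left _ _)
    rw [← hcosC]
    exact Finset.sum_pos (fun i _ => hcos i) ⟨⟨0, by omega⟩, Finset.mem_univ _⟩
  -- Bessel's inequality for `1` and `tan v`, obtained by expanding `∑ c (M u - X - Y s/c)² ≥ 0`;
  -- the cross term vanishes since `∑ s = 0`.
  have hbessel : ∀ u : Fin n → ℝ, (∑ i, c i * u i) ^ 2 + (∑ i, s i * u i) ^ 2 ≤
      M * ∑ i, c i * (u i * u i) := by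
    intro u
    set X := ∑ i, c i * u i with hX
    set Y := ∑ i, s i * u i with hY
    set S := ∑ i, c i * (u i * u i) with hS
    have hexp : ∑ i, c i * (M * u i - X - Y * (s i / c i)) ^ 2 =
        M ^ 2 * S - 2 * M * X ^ 2 - 2 * M * Y ^ 2 + X ^ 2 * (n * C) + Y ^ 2 * T := by
      have : ∀ i, c i * (M * u i - X - Y * (s i / c i)) ^ 2 =
          M ^ 2 * (c i * (u i * u i)) - 2 * M * X * (c i * u i) - 2 * M * Y * (s i * u i) +
            X ^ 2 * c i + Y ^ 2 * (s i ^ 2 / c i) + 2 * X * Y * s i := by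
        intro i
        have := (hcos i).ne'
        change c i ≠ 0 at this
        field_simp
        ring
      simp only [this, Finset.sum_add_distrib, Finset.sum_sub_distrib, ← Finset.mul_sum]
      rw [← hX, ← hY, ← hS, show ∑ i, s i = 0 from hsin0, show ∑ i, c i = n * C from hcosC,
        show ∑ i, s i ^ 2 / c i = T from rfl]
      ring
    have hnn : 0 ≤ ∑ i, c i * (M * u i - X - Y * (s i / c i)) ^ 2 :=
      Finset.sum_nonneg fun i _ => mul_nonneg (hcos i).le (sq_nonneg _)
    rw [hexp] at hnn
    have h1 : X ^ 2 * (n * C) ≤ X ^ 2 * M := by gcongr; exact le_max_left _ _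
    have h2 : Y ^ 2 * T ≤ Y ^ 2 * M := by gcongr; exact le_max_right _ _
    refine le_of_mul_le_mul_left ?_ hMpos
    linarith
  have hrad : 0 < √(1 - xi n a p K b₁ C ^ 2) := Real.sqrt_pos.2 (by nlinarith)
  -- Bessel leaves the margin `κ - (pK/n) M` in the weighted norm; the least weight `√(1 - ξ²)`
  -- converts it to the Euclidean one.
  refine isAsymptoticallyStableEquilibrium_of_neg_def field_add_two_pi (field_vSigma hn0 h)
    (hasFDerivAt_field _) (m := (κ - p * K / n * M) * √(1 - xi n a p K b₁ C ^ 2))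
    (mul_pos (by linarith) hrad) fun u => ?_
  rw [dotProduct_jacobian hn0 hsin0 hcosC]
  change p * K / n * ((∑ i, c i * u i) * (∑ i, c i * u i) +
    (∑ i, s i * u i) * (∑ i, s i * u i)) - κ * ∑ i, c i * (u i * u i) ≤ _
  have hS : √(1 - xi n a p K b₁ C ^ 2) * (u ⬝ᵥ u) ≤ ∑ i, c i * (u i * u i) := by
    rw [dotProduct, Finset.mul_sum]
    exact Finset.sum_le_sum fun i _ => mul_le_mul_of_nonneg_right (hc0 i) (mul_self_nonneg _)
  have h1 := mul_le_mul_of_nonneg_left (hbessel u) (show 0 ≤ p * K / n by positivity)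
  have h2 := mul_le_mul_of_nonneg_left hS (show 0 ≤ κ - p * K / n * M by linarith)
  linarith

/-- The equilibrium with all signs positive is unstable where `χ̄` decreases. -/
theorem isUnstableEquilibrium_vSigma_allPlus (hn : 2 ≤ n) (ha : 0 < a) (hpK : 0 < p * K)
    (hb : 0 < b₁) (h : IsConsistent a p K b₁ (allPlus n) C)
    (hcrit : xi n a p K b₁ C < 1 → beta n a p K < criticalFun n (xi n a p K b₁ C)) :
    IsUnstableEquilibrium (field n a p K b₁) (vSigma a p K b₁ (allPlus n) C) := by
  have hn0 : n ≠ 0 := by omega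
  have hn' : (0 : ℝ) < n := by positivity
  have hκ := consistent_allPlus_pos hpK hb h
  have hξ0 := xi_pos hn ha hκ
  rcases lt_or_ge (xi n a p K b₁ C) 1 with hξ | hξ
  · have hcos := cos_vSigma_allPlus_pos hn ha hpK hb h hξ
    have hxb := xi_mul_eq (n := n) (a := a) hpK hκ
    have hxt := xi_mul_tangentSum hn hpK hb h
    set T := tangentSum a p K b₁ C n
    have hT : p * K * C + b₁ < p * K / n * T := by
      rw [div_mul_eq_mul_div, lt_div_iff₀ hn']
      refine lt_of_mul_lt_mul_left ?_ hξ0.le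
      nlinarith [mul_lt_mul_of_pos_left (hcrit hξ) (mul_pos hn' hpK)]
    have hTpos : 0 < T := pos_of_mul_pos_right (hκ.trans hT) (by positivity)
    -- The direction `tan v` is orthogonal to `1` for the weights `cos v`, so the form equals `T
    -- ((pK/n) T - κ) > 0`.
    refine isUnstableEquilibrium_vSigma hn0 h
      (x := fun i => Real.tan (vSigma a p K b₁ (allPlus n) C i)) ?_
    rw [dotProduct_jacobian hn0 (sum_sin_vSigma h) (sum_cos_vSigma hn0 h)]
    have h1 : ∑ i, Real.cos (vSigma a p K b₁ (allPlus n) C i) *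
        Real.tan (vSigma a p K b₁ (allPlus n) C i) = 0 := by
      rw [← sum_sin_vSigma h]
      exact Finset.sum_congr rfl fun i _ => by rw [mul_comm, Real.tan_mul_cos (hcos i).ne']
    have h2 : ∑ i, Real.sin (vSigma a p K b₁ (allPlus n) C i) *
        Real.tan (vSigma a p K b₁ (allPlus n) C i) = T :=
      Finset.sum_congr rfl fun i _ => by rw [Real.tan_eq_sin_div_cos]; ring
    have h3 : ∑ i, Real.cos (vSigma a p K b₁ (allPlus n) C i) *
        (Real.tan (vSigma a p K b₁ (allPlus n) C i) *
          Real.tan (vSigma a p K b₁ (allPlus n) C i)) = T :=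
      Finset.sum_congr rfl fun i _ => by
        have := (hcos i).ne'
        rw [Real.tan_eq_sin_div_cos]
        field_simp
    rw [h1, h2, h3]
    nlinarith
  -- For `ξ ≥ 1` the extreme node has cosine `0`, so its diagonal entry is `pK/n > 0`.
  · obtain ⟨i, hi⟩ := exists_offset_eq hn0
    refine isUnstableEquilibrium_vSigma hn0 h (x := Pi.single i 1) ?_
    have h2 : (2 : ℝ) ≤ n := by exact_mod_cast hn
    rw [single_dotProduct_jacobian hn0 h, cos_vSigma_allPlus hn hpK hb h, hi,
      div_self (by linarith), one_mul, Real.sqrt_eq_zero_of_nonpos (by nlinarith), mul_zero,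
      sub_zero]
    positivity

end AllPlus

end ControlledKuramoto
theorem theorem3p3 (n : ℕ) (hn : 3 ≤ n) (a p K : ℝ) (ha : 0 < a) (hp : 0 < p) (hp1 : p ≤ 1)
    (hK : 0 < K)
    (hβ : ∀ ξ ∈ Set.Icc (0 : ℝ) 1,
      ξ * ControlledKuramoto.chi (ControlledKuramoto.allPlus n) ξ
        < ControlledKuramoto.beta n a p K) :
    ∃ ξ₀ ∈ Set.Ioo (0 : ℝ) 1,
      -- `ξ₀` is the unique point of local maximum on `(0, 1)`
      (∀ ξ ∈ Set.Ioo (0 : ℝ) 1,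
        IsLocalMax (ControlledKuramoto.chiBar a p K (ControlledKuramoto.allPlus n)) ξ ↔ ξ = ξ₀) ∧
      ∀ b₁ : ℝ, 0 < b₁ →
        (∀ C : ℝ, ControlledKuramoto.IsConsistent a p K b₁ (ControlledKuramoto.allPlus n) C →
          (ControlledKuramoto.xi n a p K b₁ C < ξ₀ →
            ControlledKuramoto.IsAsymptoticallyStableEquilibrium
              (ControlledKuramoto.field n a p K b₁)
              (ControlledKuramoto.vSigma a p K b₁ (ControlledKuramoto.allPlus n) C)) ∧
          (ξ₀ < ControlledKuramoto.xi n a p K b₁ C →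
            ControlledKuramoto.IsUnstableEquilibrium
              (ControlledKuramoto.field n a p K b₁)
              (ControlledKuramoto.vSigma a p K b₁ (ControlledKuramoto.allPlus n) C))) ∧
        (∀ (σ : Fin n → ℤˣ) (C : ℝ), (∃ i, σ i = -1) →
          ControlledKuramoto.IsConsistent a p K b₁ σ C →
            ControlledKuramoto.IsUnstableEquilibrium
              (ControlledKuramoto.field n a p K b₁)
              (ControlledKuramoto.vSigma a p K b₁ σ C)) := by
  have hn2 : 2 ≤ n := by omega
  have hn0 : n ≠ 0 := by omega
  have hpK : 0 < p * K := mul_pos hp hK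
  have hβ0 : 0 < ControlledKuramoto.beta n a p K := by
    simpa using hβ 0 ⟨le_rfl, zero_le_one⟩
  obtain ⟨ξ₀, hξ₀, hcrit⟩ := ControlledKuramoto.exists_criticalFun_eq hn2 hβ0
  have hmono := ControlledKuramoto.strictMonoOn_criticalFun hn2
  refine ⟨ξ₀, hξ₀, fun ξ hξ => ControlledKuramoto.isLocalMax_chiBar_iff hn2 hβ hξ₀ hcrit hξ,
    fun b₁ hb => ⟨fun C hC => ?_, fun σ C hσ hC =>
      ControlledKuramoto.isUnstableEquilibrium_vSigma_of_exists_neg hn0 hpK hb hσ hC⟩⟩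
  have hξpos := ControlledKuramoto.xi_pos hn2 ha
    (ControlledKuramoto.consistent_allPlus_pos hpK hb hC)
  refine ⟨fun hlt => ?_, fun hgt => ?_⟩
  · have hξ1 := hlt.trans hξ₀.2
    exact ControlledKuramoto.isAsymptoticallyStable_vSigma_allPlus hn2 ha hpK hb hC hξ1
      ((hmono ⟨hξpos.le, hξ1⟩ ⟨hξ₀.1.le, hξ₀.2⟩ hlt).trans_eq hcrit)
  · exact ControlledKuramoto.isUnstableEquilibrium_vSigma_allPlus hn2 ha hpK hb hC fun hξ1 =>
      hcrit.symm.trans_lt (hmono ⟨hξ₀.1.le, hξ₀.2⟩ ⟨hξpos.le, hξ1⟩ hgt)
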